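/- **Proposition (Koszul dual of $\mathrm{di}\text{-}\mathrm{Lie}^{\mathrm I}$).** Let $K$ be a field of characteristic $0$. A binary quadratic operad is $P(E,R)=T(E)/(R)$, where $E$ is a finite-dimensional $S_2$-module, $T(E)$ is the free symmetric operad generated by $E$ in arity two, $R\subset T(E)(3)$ is an $S_3$-submodule and $(R)$ is the operadic ideal generated by $R$. Its Koszul dual operad is $P(E,R)^{(!)}=P(E^\vee,R^\perp)$, where $E^\vee=E^*\otimes\mathrm{sgn}$ and $R^\perp$ is the orthogonal of $R$ for the standard pairing between $T(E^\vee)(3)$ and $T(E)(3)$ (both are sums of three copies, indexed by $f(e(x_1,x_2),x_3)$, $f(e(x_2,x_3),x_1)$, $f(e(x_3,x_1),x_2)$, of $E^\vee\otimes E^\vee$ and $E\otimes E$ respectively, paired copy by copy). Let $\mathrm{di}\text{-}\mathrm{Lie}^{\mathrm I}$ be the operad of initial Lie dialgebras, i.e. the quadratic operad generated by one binary operation $ab$ without symmetry ($E=K[S_2]$), with the Leibniz identity $$(ab)c=a(bc)-b(ac)$$ and the identity $$a(bc)-a(cb)-b(ac)+b(ca)+c(ab)-c(ba)=0 .$$ Then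 the Koszul dual operad $\mathrm{di}\text{-}\mathrm{Lie}^{\mathrm I\,(!)}$ is the quadratic operad generated by one binary operation without symmetry, with the left-commutativity identity $$c(ab)=a(cb)$$ and the identity $$(uv)w+(vu)w-u(vw)+u(wv)-(wu)v-(uw)v=0 .$$ More precisely, there is an isomorphism of symmetric $K$-linear operads between the two that sends the element of $E^\vee$ which is the coordinate functional of the generating operation $x_1x_2$ (dual to the basis $x_1x_2,\ x_2x_1$ of $E$) to the generating operation. -/

import Mathlib

universe u

noncomputable section

namespace KoszulDualDiLie

/-! ### Symmetric operads

A symmetric `K`-linear operad in partial-composition form, indexed by finite sets: `obj A` is the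
space of operations whose inputs are labelled by `A` (the classical `P(n)` is `obj (Fin n)`, with
`S_n` acting through `relabel`), and `comp p q` plugs `q` into the input `none` of `p`. -/

/-- Move the marked input of the right-hand summand outside. -/
def sumOptionEquiv (A B : Type) : A ⊕ Option B ≃ Option (A ⊕ B) where
  toFun := fun x => match x with
    | Sum.inl a => some (Sum.inl a)
    | Sum.inr none => none
    | Sum.inr (some b) => some (Sum.inr b)
  invFun := fun x => match x with
    | none => Sum.inr none
    | some (Sum.inl a) => Sum.inl a
    | some (Sum.inr b) => Sum.inr (some b)
  left_inv := by rintro (a | _ | b) <;> rfl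
  right_inv := by rintro (_ | a | b) <;> rfl

/-- Move the marked input of the left-hand summand outside. -/
def optionSumEquiv (A B : Type) : Option A ⊕ B ≃ Option (A ⊕ B) where
  toFun := fun x => match x with
    | Sum.inl none => none
    | Sum.inl (some a) => some (Sum.inl a)
    | Sum.inr b => some (Sum.inr b)
  invFun := fun x => match x with
    | none => Sum.inl none
    | some (Sum.inl a) => Sum.inl (some a)
    | some (Sum.inr b) => Sum.inr b
  left_inv := by rintro ((_ | a) | b) <;> rfl
  right_inv := by rintro (_ | a | b) <;> rfl

/-- Exchange two marked inputs. -/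
def optionSwap (A : Type) : Option (Option A) ≃ Option (Option A) where
  toFun := fun x => match x with
    | none => some none
    | some none => none
    | some (some a) => some (some a)
  invFun := fun x => match x with
    | none => some none
    | some none => none
    | some (some a) => some (some a)
  left_inv := by rintro (_ | _ | a) <;> rfl
  right_inv := by rintro (_ | _ | a) <;> rfl

/-- Exchange the last two summands. -/
def sumRightComm (A B C : Type) : (A ⊕ B) ⊕ C ≃ (A ⊕ C) ⊕ B where
  toFun := fun x => match x with
    | Sum.inl (Sum.inl a) => Sum.inl (Sum.inl a)
    | Sum.inl (Sum.inr b) => Sum.inr b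
    | Sum.inr c => Sum.inl (Sum.inr c)
  invFun := fun x => match x with
    | Sum.inl (Sum.inl a) => Sum.inl (Sum.inl a)
    | Sum.inl (Sum.inr c) => Sum.inr c
    | Sum.inr b => Sum.inl (Sum.inr b)
  left_inv := by rintro ((a | b) | c) <;> rfl
  right_inv := by rintro ((a | b) | c) <;> rfl

/-- A symmetric operad in `K`-vector spaces. The axioms are: functoriality in the label set,
equivariance of partial composition, the two unit laws, and the sequential and parallel
associativity laws. -/
structure Operad (K : Type u) [Field K] where
  obj : (A : Type) → [Finite A] → Type u
  [addCommGroup : ∀ (A : Type) [Finite A], AddCommGroup (obj A)]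
  [module : ∀ (A : Type) [Finite A], Module K (obj A)]
  relabel : ∀ {A B : Type} [Finite A] [Finite B], A ≃ B → (obj A →ₗ[K] obj B)
  one : obj Unit
  comp : ∀ {A B : Type} [Finite A] [Finite B], obj (Option A) →ₗ[K] obj B →ₗ[K] obj (A ⊕ B)
  relabel_refl : ∀ {A : Type} [Finite A] (p : obj A), relabel (Equiv.refl A) p = p
  relabel_trans : ∀ {A B C : Type} [Finite A] [Finite B] [Finite C] (e : A ≃ B) (f : B ≃ C)
    (p : obj A), relabel (e.trans f) p = relabel f (relabel e p)
  comp_relabel : ∀ {A A' B B' : Type} [Finite A] [Finite A'] [Finite B] [Finite B']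
    (e : A ≃ A') (f : B ≃ B') (p : obj (Option A)) (q : obj B),
    comp (relabel e.optionCongr p) (relabel f q) = relabel (Equiv.sumCongr e f) (comp p q)
  comp_one : ∀ {A : Type} [Finite A] (p : obj (Option A)),
    comp p one = relabel (Equiv.optionEquivSumPUnit A) p
  one_comp : ∀ {B : Type} [Finite B] (e : Unit ≃ Option Empty) (q : obj B),
    comp (relabel e one) q = relabel (Equiv.emptySum Empty B).symm q
  comp_seq : ∀ {A B C : Type} [Finite A] [Finite B] [Finite C]
    (p : obj (Option A)) (q : obj (Option B)) (r : obj C),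
    relabel (Equiv.sumAssoc A B C) (comp (relabel (sumOptionEquiv A B) (comp p q)) r) =
      comp p (comp q r)
  comp_par : ∀ {A B C : Type} [Finite A] [Finite B] [Finite C]
    (p : obj (Option (Option A))) (q : obj B) (r : obj C),
    relabel (sumRightComm A B C) (comp (relabel (optionSumEquiv A B) (comp p q)) r) =
      comp (relabel (optionSumEquiv A C) (comp (relabel (optionSwap A) p) r)) q

attribute [instance] Operad.addCommGroup Operad.module

variable {K : Type u} [Field K]

/-- An isomorphism of operads: linear bijections in every arity that preserve relabelling, the
unit and composition. -/
structure OperadIso (P Q : Operad K) where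
  equiv : ∀ (A : Type) [Finite A], P.obj A ≃ₗ[K] Q.obj A
  map_relabel : ∀ {A B : Type} [Finite A] [Finite B] (e : A ≃ B) (p : P.obj A),
    equiv B (P.relabel e p) = Q.relabel e (equiv A p)
  map_one : equiv Unit P.one = Q.one
  map_comp : ∀ {A B : Type} [Finite A] [Finite B] (p : P.obj (Option A)) (q : P.obj B),
    equiv (A ⊕ B) (P.comp p q) = Q.comp (equiv (Option A) p) (equiv B q)

/-! ### Ideals and quotients -/

/-- A two-sided operadic ideal. -/
structure OperadIdeal (P : Operad K) where
  carrier : ∀ (A : Type) [Finite A], Submodule K (P.obj A)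
  relabel_mem : ∀ {A B : Type} [Finite A] [Finite B] (e : A ≃ B) {p : P.obj A},
    p ∈ carrier A → P.relabel e p ∈ carrier B
  comp_mem_left : ∀ {A B : Type} [Finite A] [Finite B] {p : P.obj (Option A)} (q : P.obj B),
    p ∈ carrier (Option A) → P.comp p q ∈ carrier (A ⊕ B)
  comp_mem_right : ∀ {A B : Type} [Finite A] [Finite B] (p : P.obj (Option A)) {q : P.obj B},
    q ∈ carrier B → P.comp p q ∈ carrier (A ⊕ B)

/-- The operadic ideal generated by a family of elements: the intersection of all the ideals that
contain it. -/
def OperadIdeal.span (P : Operad K) (S : ∀ n : ℕ, Set (P.obj (Fin n))) : OperadIdeal P where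
  carrier A _ := ⨅ (J : OperadIdeal P) (_ : ∀ n, S n ⊆ J.carrier (Fin n)), J.carrier A
  relabel_mem e p hp := by
    simp only [Submodule.mem_iInf] at hp ⊢
    exact fun J hJ => J.relabel_mem e (hp J hJ)
  comp_mem_left q hp := by
    simp only [Submodule.mem_iInf] at hp ⊢
    exact fun J hJ => J.comp_mem_left q (hp J hJ)
  comp_mem_right p q hq := by
    simp only [Submodule.mem_iInf] at hq ⊢
    exact fun J hJ => J.comp_mem_right p (hq J hJ)

/-- Relabelling on the quotient by an ideal. -/
def quotRelabel (P : Operad K) (I : OperadIdeal P) {A B : Type} [Finite A] [Finite B]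
    (e : A ≃ B) : (P.obj A ⧸ I.carrier A) →ₗ[K] (P.obj B ⧸ I.carrier B) :=
  Submodule.mapQ _ _ (P.relabel e) (fun _ hp => I.relabel_mem e hp)

/-- Composition on the quotient by an ideal. -/
def quotComp (P : Operad K) (I : OperadIdeal P) {A B : Type} [Finite A] [Finite B] :
    (P.obj (Option A) ⧸ I.carrier (Option A)) →ₗ[K]
      (P.obj B ⧸ I.carrier B) →ₗ[K] (P.obj (A ⊕ B) ⧸ I.carrier (A ⊕ B)) :=
  Submodule.liftQ _
    { toFun := fun p => Submodule.mapQ _ _ (P.comp p) (fun _ hq => I.comp_mem_right p hq)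
      map_add' := by
        intro p p'
        ext q
        simp
      map_smul' := by
        intro c p
        ext q
        simp }
    (by
      intro p hp
      rw [LinearMap.mem_ker]
      ext q
      simpa using (Submodule.Quotient.mk_eq_zero _).2 (I.comp_mem_left q hp))

/-- The quotient of an operad by an operadic ideal. -/
def Operad.quotient (P : Operad K) (I : OperadIdeal P) : Operad K where
  obj A _ := P.obj A ⧸ I.carrier A
  relabel e := quotRelabel P I e
  one := Submodule.Quotient.mk P.one
  comp := quotComp P I
  relabel_refl p := by
    obtain ⟨p, rfl⟩ := Submodule.Quotient.mk_surjective _ p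
    exact congrArg Submodule.Quotient.mk (P.relabel_refl p)
  relabel_trans e f p := by
    obtain ⟨p, rfl⟩ := Submodule.Quotient.mk_surjective _ p
    exact congrArg Submodule.Quotient.mk (P.relabel_trans e f p)
  comp_relabel e f p q := by
    obtain ⟨p, rfl⟩ := Submodule.Quotient.mk_surjective _ p
    obtain ⟨q, rfl⟩ := Submodule.Quotient.mk_surjective _ q
    exact congrArg Submodule.Quotient.mk (P.comp_relabel e f p q)
  comp_one p := by
    obtain ⟨p, rfl⟩ := Submodule.Quotient.mk_surjective _ p
    exact congrArg Submodule.Quotient.mk (P.comp_one p)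
  one_comp e q := by
    obtain ⟨q, rfl⟩ := Submodule.Quotient.mk_surjective _ q
    exact congrArg Submodule.Quotient.mk (P.one_comp e q)
  comp_seq p q r := by
    obtain ⟨p, rfl⟩ := Submodule.Quotient.mk_surjective _ p
    obtain ⟨q, rfl⟩ := Submodule.Quotient.mk_surjective _ q
    obtain ⟨r, rfl⟩ := Submodule.Quotient.mk_surjective _ r
    exact congrArg Submodule.Quotient.mk (P.comp_seq p q r)
  comp_par p q r := by
    obtain ⟨p, rfl⟩ := Submodule.Quotient.mk_surjective _ p
    obtain ⟨q, rfl⟩ := Submodule.Quotient.mk_surjective _ q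
    obtain ⟨r, rfl⟩ := Submodule.Quotient.mk_surjective _ r
    exact congrArg Submodule.Quotient.mk (P.comp_par p q r)

/-! ### The free operad on a set of binary operations without symmetry -/

/-- Binary trees with vertices decorated by `X` and leaves labelled by `A`; `node x l r` is the
monomial `x(l, r)`. -/
inductive BTree (X : Type u) (A : Type) : Type u
  | leaf (a : A) : BTree X A
  | node (x : X) (l r : BTree X A) : BTree X A

namespace BTree

variable {X : Type u} {A B C : Type}

/-- The list of leaf labels, from left to right. -/
def leaves : BTree X A → List A
  | leaf a => [a]
  | node _ l r => leaves l ++ leaves r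

/-- Substitution of trees for the leaves. -/
def subst (f : A → BTree X B) : BTree X A → BTree X B
  | leaf a => f a
  | node x l r => node x (subst f l) (subst f r)

/-- Renaming of the leaves. -/
def map (f : A → B) (t : BTree X A) : BTree X B := t.subst (fun a => leaf (f a))

/-- Plug the tree `s` into the leaf `none` of `t`. -/
def graft (t : BTree X (Option A)) (s : BTree X B) : BTree X (A ⊕ B) :=
  t.subst (fun o => match o with
    | none => s.map Sum.inr
    | some a => leaf (Sum.inl a))

/-- Every label occurs exactly once. -/
def IsMultilinear (t : BTree X A) : Prop := t.leaves.Nodup ∧ ∀ a, a ∈ t.leaves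

theorem subst_subst (f : A → BTree X B) (g : B → BTree X C) (t : BTree X A) :
    (t.subst f).subst g = t.subst (fun a => (f a).subst g) := by
  induction t with
  | leaf a => rfl
  | node x l r hl hr => simp [subst, hl, hr]

theorem subst_leaf (t : BTree X A) : t.subst (fun a => (leaf a : BTree X A)) = t := by
  induction t with
  | leaf a => rfl
  | node x l r hl hr => simp [subst, hl, hr]

theorem leaves_subst (f : A → BTree X B) (t : BTree X A) :
    (t.subst f).leaves = t.leaves.flatMap (fun a => (f a).leaves) := by
  induction t with
  | leaf a => simp [subst, leaves]
  | node x l r hl hr => simp [subst, leaves, hl, hr]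

theorem leaves_map (f : A → B) (t : BTree X A) : (t.map f).leaves = t.leaves.map f := by
  rw [map, leaves_subst]
  simp only [leaves]
  induction t.leaves with
  | nil => rfl
  | cons a l ih => simp [ih]

theorem IsMultilinear.map {t : BTree X A} (ht : t.IsMultilinear) (e : A ≃ B) :
    (t.map e).IsMultilinear := by
  refine ⟨?_, fun b => ?_⟩
  · rw [leaves_map]
    exact ht.1.map e.injective
  · rw [leaves_map]
    exact List.mem_map.2 ⟨e.symm b, ht.2 _, by simp⟩

theorem IsMultilinear.graft {t : BTree X (Option A)} {s : BTree X B} (ht : t.IsMultilinear)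
    (hs : s.IsMultilinear) : (t.graft s).IsMultilinear := by
  refine ⟨?_, ?_⟩
  · rw [BTree.graft, leaves_subst, List.nodup_flatMap]
    refine ⟨?_, ht.1.imp ?_⟩
    · rintro (_ | a) _
      · simp only [leaves_map]
        exact hs.1.map Sum.inr_injective
      · simp [leaves]
    · rintro (_ | a) (_ | b) hab <;> simp [Function.onFun, leaves_map, leaves, List.Disjoint] at *
      exact hab
  · rintro (a | b)
    · rw [BTree.graft, leaves_subst, List.mem_flatMap]
      exact ⟨some a, ht.2 _, by simp [leaves]⟩
    · rw [BTree.graft, leaves_subst, List.mem_flatMap]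
      exact ⟨none, ht.2 _, by simpa [leaves_map] using hs.2 b⟩

end BTree

/-- Multilinear trees: each element of `A` labels exactly one leaf. -/
@[ext]
structure MTree (X : Type u) (A : Type) : Type u where
  tree : BTree X A
  isMultilinear : tree.IsMultilinear

namespace MTree

variable {X : Type u} {A B C : Type}

/-- Relabelling of the leaves. -/
def relabel (e : A ≃ B) (t : MTree X A) : MTree X B := ⟨t.1.map e, t.2.map e⟩

/-- Grafting at the leaf `none`. -/
def graft (t : MTree X (Option A)) (s : MTree X B) : MTree X (A ⊕ B) :=
  ⟨t.1.graft s.1, t.2.graft s.2⟩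

/-- The trivial tree. -/
def one : MTree X Unit := ⟨BTree.leaf (), by simp [BTree.IsMultilinear, BTree.leaves]⟩

theorem relabel_refl (t : MTree X A) : t.relabel (Equiv.refl A) = t :=
  MTree.ext (BTree.subst_leaf t.1)

theorem relabel_trans (e : A ≃ B) (f : B ≃ C) (t : MTree X A) :
    t.relabel (e.trans f) = (t.relabel e).relabel f :=
  MTree.ext (by simp [relabel, BTree.map, BTree.subst_subst, BTree.subst])

theorem graft_relabel {A' B' : Type} (e : A ≃ A') (f : B ≃ B') (t : MTree X (Option A))
    (s : MTree X B) : (t.relabel e.optionCongr).graft (s.relabel f) =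
      (t.graft s).relabel (Equiv.sumCongr e f) := by
  apply MTree.ext
  simp only [relabel, graft, BTree.map, BTree.graft, BTree.subst_subst, BTree.subst]
  congr 1
  funext o
  cases o <;> simp [BTree.subst, BTree.subst_subst]

theorem graft_one (t : MTree X (Option A)) :
    t.graft one = t.relabel (Equiv.optionEquivSumPUnit A) := by
  apply MTree.ext
  simp only [relabel, graft, one, BTree.map, BTree.graft]
  congr 1
  funext o
  cases o <;> simp [BTree.subst]

theorem one_graft (e : Unit ≃ Option Empty) (s : MTree X B) :
    (one.relabel e).graft s = s.relabel (Equiv.emptySum Empty B).symm := by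
  apply MTree.ext
  have he : e () = none := by
    rcases h : e () with _ | a
    · rfl
    · exact a.elim
  simp only [relabel, graft, one, BTree.map, BTree.graft, BTree.subst, he]
  rfl

theorem graft_seq (p : MTree X (Option A)) (q : MTree X (Option B)) (r : MTree X C) :
    (((p.graft q).relabel (sumOptionEquiv A B)).graft r).relabel (Equiv.sumAssoc A B C) =
      p.graft (q.graft r) := by
  apply MTree.ext
  simp only [relabel, graft, BTree.map, BTree.graft, BTree.subst_subst, BTree.subst]
  congr 1
  funext o
  rcases o with _ | a
  · simp only [BTree.subst_subst, BTree.subst]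
    congr 1
    funext o
    rcases o with _ | b
    · simp [BTree.subst_subst, BTree.subst, sumOptionEquiv]
    · simp [BTree.subst, sumOptionEquiv]
  · simp [BTree.subst, sumOptionEquiv]

theorem graft_par (p : MTree X (Option (Option A))) (q : MTree X B) (r : MTree X C) :
    (((p.graft q).relabel (optionSumEquiv A B)).graft r).relabel (sumRightComm A B C) =
      ((((p.relabel (optionSwap A)).graft r).relabel (optionSumEquiv A C)).graft q) := by
  apply MTree.ext
  simp only [relabel, graft, BTree.map, BTree.graft, BTree.subst_subst, BTree.subst]
  congr 1
  funext o
  rcases o with _ | _ | a <;>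
    simp [BTree.subst_subst, BTree.subst, optionSumEquiv, optionSwap, sumRightComm]

end MTree

/-- Grafting, extended bilinearly. -/
def freeComp (K : Type u) [Field K] (X : Type u) (A B : Type) :
    (MTree X (Option A) →₀ K) →ₗ[K] (MTree X B →₀ K) →ₗ[K] (MTree X (A ⊕ B) →₀ K) :=
  Finsupp.linearCombination K (fun t => Finsupp.lmapDomain K K (fun s => t.graft s))

theorem freeComp_single (X : Type u) (A B : Type) (t : MTree X (Option A)) (s : MTree X B)
    (a b : K) : freeComp K X A B (Finsupp.single t a) (Finsupp.single s b) =
      Finsupp.single (t.graft s) (a * b) := by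
  simp [freeComp, Finsupp.linearCombination_single, Finsupp.mapDomain_single]

theorem finsupp_ext {T M : Type u} [AddCommGroup M] [Module K M] (f g : (T →₀ K) →ₗ[K] M)
    (h : ∀ t, f (Finsupp.single t 1) = g (Finsupp.single t 1)) (x : T →₀ K) : f x = g x := by
  have : f = g := by
    ext t
    simpa using h t
  rw [this]

/-- The free operad on a set `X` of binary operations (without any symmetry): its operations with
inputs `A` are the linear combinations of multilinear monomials. -/
def freeOperad (K : Type u) [Field K] (X : Type u) : Operad K where
  obj A _ := MTree X A →₀ K
  relabel e := Finsupp.lmapDomain K K (MTree.relabel e)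
  one := Finsupp.single MTree.one 1
  comp := freeComp K X _ _
  relabel_refl p := by
    refine (finsupp_ext (Finsupp.lmapDomain K K (MTree.relabel _)) LinearMap.id (fun t => ?_) p)
    simp [MTree.relabel_refl]
  relabel_trans e f p := by
    refine (finsupp_ext (Finsupp.lmapDomain K K (MTree.relabel _))
      (Finsupp.lmapDomain K K (MTree.relabel f) ∘ₗ Finsupp.lmapDomain K K (MTree.relabel e))
      (fun t => ?_) p)
    simp [MTree.relabel_trans]
  comp_relabel e f p q := by
    induction p using Finsupp.induction_linear with
    | zero => simp
    | add p p' hp hp' => simp only [map_add, LinearMap.add_apply, hp, hp']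
    | single t a =>
      induction q using Finsupp.induction_linear with
      | zero => simp
      | add q q' hq hq' => simp only [map_add, hq, hq']
      | single s b =>
        simp [-Finsupp.single_mul, Finsupp.mapDomain_single, freeComp_single, MTree.graft_relabel]
  comp_one p := by
    induction p using Finsupp.induction_linear with
    | zero => simp
    | add p p' hp hp' => simp only [map_add, LinearMap.add_apply, hp, hp']
    | single t a => simp [-Finsupp.single_mul, Finsupp.mapDomain_single, freeComp_single, MTree.graft_one]
  one_comp e q := by
    induction q using Finsupp.induction_linear with
    | zero => simp
    | add q q' hq hq' => simp only [map_add, hq, hq']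
    | single s b => simp [-Finsupp.single_mul, Finsupp.mapDomain_single, freeComp_single, MTree.one_graft]
  comp_seq p q r := by
    induction p using Finsupp.induction_linear with
    | zero => simp
    | add p p' hp hp' => simp only [map_add, LinearMap.add_apply, hp, hp']
    | single t a =>
      induction q using Finsupp.induction_linear with
      | zero => simp
      | add q q' hq hq' => simp only [map_add, LinearMap.add_apply, hq, hq']
      | single s b =>
        induction r using Finsupp.induction_linear with
        | zero => simp
        | add r r' hr hr' => simp only [map_add, hr, hr']
        | single u c =>
          simp [-Finsupp.single_mul, Finsupp.mapDomain_single, freeComp_single, MTree.graft_seq, mul_assoc]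
  comp_par p q r := by
    induction p using Finsupp.induction_linear with
    | zero => simp
    | add p p' hp hp' => simp only [map_add, LinearMap.add_apply, hp, hp']
    | single t a =>
      induction q using Finsupp.induction_linear with
      | zero => simp
      | add q q' hq hq' => simp only [map_add, LinearMap.add_apply, hq, hq']
      | single s b =>
        induction r using Finsupp.induction_linear with
        | zero => simp
        | add r r' hr hr' => simp only [map_add, LinearMap.add_apply, hr, hr']
        | single u c =>
          simp [-Finsupp.single_mul, Finsupp.mapDomain_single, freeComp_single, MTree.graft_par, mul_right_comm]

/-! ### Binary quadratic operads and their Koszul duals -/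

section Words

variable (K) {X : Type u}

open Classical in
/-- A multilinear tree, as an element of the free operad (zero if the tree is not multilinear). -/
def ofTree {A : Type} (t : BTree X A) : MTree X A →₀ K :=
  if h : t.IsMultilinear then Finsupp.single ⟨t, h⟩ 1 else 0

/-- The monomial `x(i, j)`, for distinct `i, j`. -/
def mono2 (x : X) (i j : Fin 2) : MTree X (Fin 2) →₀ K :=
  ofTree K (.node x (.leaf i) (.leaf j))

end Words

/-- Binary quadratic data `(E, R)`: a finite-dimensional representation `E` of `S_2`, the
transposition acting by `swap`, and a set `R` of relations in arity three between the operations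
of `E`. The space of relations is the `S_3`-submodule generated by `R`. -/
structure QuadraticData (K : Type u) [Field K] where
  E : Type u
  [addCommGroup : AddCommGroup E]
  [module : Module K E]
  [finite : Module.Finite K E]
  swap : E →ₗ[K] E
  swap_swap : ∀ e, swap (swap e) = e
  rel : Set (MTree E (Fin 3) →₀ K)

attribute [instance] QuadraticData.addCommGroup QuadraticData.module QuadraticData.finite

namespace QuadraticData

/-- The relations of arity two express that a vertex depends linearly on its decoration and that
`swap` exchanges the two inputs (dividing by them turns the free operad on the set `E` into the
free operad `T(E)` on the `S_2`-module `E`); those of arity three are the given ones. -/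
inductive Relation (D : QuadraticData K) : ∀ n : ℕ, (MTree D.E (Fin n) →₀ K) → Prop
  | add (e f : D.E) : Relation D 2 (mono2 K (e + f) 0 1 - (mono2 K e 0 1 + mono2 K f 0 1))
  | smul (c : K) (e : D.E) : Relation D 2 (mono2 K (c • e) 0 1 - c • mono2 K e 0 1)
  | swap (e : D.E) : Relation D 2 (mono2 K (D.swap e) 0 1 - mono2 K e 1 0)
  | rel (r : MTree D.E (Fin 3) →₀ K) (hr : r ∈ D.rel) : Relation D 3 r

/-- The ideal of relations. -/
def ideal (D : QuadraticData K) : OperadIdeal (freeOperad K D.E) :=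
  OperadIdeal.span (freeOperad K D.E) (fun n => {r | D.Relation n r})

/-- The quadratic operad `P(E, R) = T(E) / (R)`. -/
def operad (D : QuadraticData K) : Operad K := (freeOperad K D.E).quotient D.ideal

/-- The operation of `P(E, R)` given by an element of `E`. -/
def gen (D : QuadraticData K) (e : D.E) : D.operad.obj (Fin 2) :=
  Submodule.Quotient.mk (p := D.ideal.carrier (Fin 2)) (mono2 K e 0 1)

/-- The normal form of a tree with three leaves. As a vector space `T(E)(3)` is the sum of three
copies of `E ⊗ E`, spanned by `f(e(0, 1), 2)`, `f(e(1, 2), 0)` and `f(e(2, 0), 1)`; the value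
`(k, f, e)` stands for the one of these elements whose outer leaf is `k`. -/
def normalForm {E : Type u} (swap : E → E) : BTree E (Fin 3) → Option (Fin 3 × E × E)
  | .node f (.node e (.leaf i) (.leaf j)) (.leaf k) =>
      some (k, f, if j = i + 1 then e else swap e)
  | .node f (.leaf k) (.node e (.leaf i) (.leaf j)) =>
      some (k, swap f, if j = i + 1 then e else swap e)
  | _ => none

/-- The pairing of a tree over `E^∨` with a tree over `E`: on normal forms
`⟨(k, φ, ε), (k', f, e)⟩` is `φ(f) ε(e)` if `k = k'` and zero otherwise. The transposition acts on
`E^∨ = E^* ⊗ sgn` by minus the transpose of `swap`. -/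
def pairTree (D : QuadraticData K) (s : BTree (Module.Dual K D.E) (Fin 3))
    (t : BTree D.E (Fin 3)) : K :=
  match normalForm (fun φ : Module.Dual K D.E => -(φ ∘ₗ D.swap)) s, normalForm D.swap t with
  | some (k, φ, ε), some (k', f, e) => if k = k' then φ f * ε e else 0
  | _, _ => 0

/-- The pairing between `T(E^∨)(3)` and `T(E)(3)`, on representatives. -/
def pairing (D : QuadraticData K) (x : MTree (Module.Dual K D.E) (Fin 3) →₀ K)
    (y : MTree D.E (Fin 3) →₀ K) : K :=
  x.sum fun s a =>
    y.sum fun t b => a * b * D.pairTree s.tree t.tree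

/-- The Koszul dual data `(E^∨, R^⊥)`: here `E^∨ = E^* ⊗ sgn`, and `R^⊥` is the orthogonal of the
`S_3`-submodule generated by `R`. -/
def koszulDual (D : QuadraticData K) : QuadraticData K where
  E := Module.Dual K D.E
  swap :=
    { toFun := fun φ => -(φ ∘ₗ D.swap)
      map_add' := by
        intro φ ψ
        ext e
        simp [add_comm]
      map_smul' := by
        intro c φ
        ext e
        simp }
  swap_swap := by
    intro φ
    ext e
    simp [D.swap_swap]
  rel := {x | ∀ r ∈ D.rel, ∀ σ : Equiv.Perm (Fin 3),
    D.pairing x (r.mapDomain (MTree.relabel σ)) = 0}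

end QuadraticData

/-! ### Operads generated by one binary operation without symmetry -/

/-- The generator `x_0 x_1` of the regular representation `K × K` of `S_2`; the second basis
vector is the opposite operation `x_1 x_0`. -/
def mu (K : Type u) [Field K] : K × K := (1, 0)

/-- `lword K i j k` is the word `(x_i x_j) x_k`, for distinct `i, j, k`. -/
def lword (K : Type u) [Field K] (i j k : Fin 3) : MTree (K × K) (Fin 3) →₀ K :=
  ofTree K (.node (mu K) (.node (mu K) (.leaf i) (.leaf j)) (.leaf k))

/-- `rword K i j k` is the word `x_i (x_j x_k)`, for distinct `i, j, k`. -/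
def rword (K : Type u) [Field K] (i j k : Fin 3) : MTree (K × K) (Fin 3) →₀ K :=
  ofTree K (.node (mu K) (.leaf i) (.node (mu K) (.leaf j) (.leaf k)))

/-- The operad of algebras with one bilinear product subject to the multilinear identities `r = 0`
of degree three, `r ∈ R`. -/
def oneProduct (K : Type u) [Field K] (R : Set (MTree (K × K) (Fin 3) →₀ K)) :
    QuadraticData K where
  E := K × K
  swap := LinearMap.prod (LinearMap.snd K K K) (LinearMap.fst K K K)
  swap_swap := by simp
  rel := R

/-- Initial Lie dialgebras: Leibniz algebras, `(ab)c = a(bc) - b(ac)`, that satisfy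
`a(bc) - a(cb) - b(ac) + b(ca) + c(ab) - c(ba) = 0` (with `a, b, c = x_0, x_1, x_2`). -/
def diLieI (K : Type u) [Field K] : QuadraticData K :=
  oneProduct K
    {lword K 0 1 2 - (rword K 0 1 2 - rword K 1 0 2),
     rword K 0 1 2 - rword K 0 2 1 - rword K 1 0 2 + rword K 1 2 0 + rword K 2 0 1 - rword K 2 1 0}

/-- Left-commutative algebras, `c(ab) = a(cb)`, that satisfy
`(uv)w + (vu)w - u(vw) + u(wv) - (wu)v - (uw)v = 0`
(with `a, b, c = x_0, x_1, x_2` and `u, v, w = x_0, x_1, x_2`). -/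
def leftComm (K : Type u) [Field K] : QuadraticData K :=
  oneProduct K
    {rword K 2 0 1 - rword K 0 2 1,
     lword K 0 1 2 + lword K 1 0 2 - rword K 0 1 2 + rword K 0 2 1 - lword K 2 0 1 - lword K 0 2 1}

end KoszulDualDiLie

end

noncomputable section

namespace KoszulDualDiLie

variable {K : Type u} [Field K]

/-! ### Isomorphisms of operads, ideals and quotients -/

/-! Let θ : E^∨ → E send φ to (φ(x_1x_2), -φ(x_2x_1)). The minus sign absorbs the twist by sgn, so θ
is an isomorphism of S_2-modules taking the coordinate functional of the generator to the generator.
It induces an isomorphism of the free operads, and the linearity and symmetry relations of arity two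
correspond under it. What remains is that θ matches R^⊥ with the left-commutative relations in arity
three (`operadCongr`).

Write L(ijk) = (x_i x_j)x_k and R(ijk) = x_i(x_j x_k). In the twelve words the pairing, transported
along θ, is diagonal with entries ±1, so modulo the arity-two relations θ(x) is the signed sum of
the ⟨x, w⟩ w (`oneProj_dualRegularTree_eq_sum`). Suppose x is in R^⊥. The Leibniz identity gives ⟨x,
L(ijk)⟩ = ⟨x, R(ijk)⟩ - ⟨x, R(jik)⟩. Put d_k = ⟨x, L(k+1, k+2, k)⟩, indices mod 3.
Left-commutativity makes R(ijk) depend only on k, and the expansion collapses to ∑ d_k S_k with S_k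
= L(k+1, k+2, k) + L(k+2, k+1, k) - R(k+1, k+2, k). The second dual identity says that all S_k are
equal, and the second identity of initial Lie dialgebras says that ∑ d_k = 0; hence θ(x) vanishes
(`dualRegularTree_mem_ideal`).

Conversely, the dual relations are orthogonal to every relabelling of the original ones, by the
table of pairings of words (`dualRegularTree_symm_mem_rel`). -/

theorem OperadIdeal.subset_span (P : Operad K) (S : ∀ n : ℕ, Set (P.obj (Fin n))) (n : ℕ) :
    S n ⊆ (OperadIdeal.span P S).carrier (Fin n) := by
  intro p hp
  simp only [OperadIdeal.span, SetLike.mem_coe, Submodule.mem_iInf]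
  exact fun J hJ => hJ n hp

theorem OperadIdeal.span_le {P : Operad K} {S : ∀ n : ℕ, Set (P.obj (Fin n))}
    {J : OperadIdeal P} (h : ∀ n, S n ⊆ J.carrier (Fin n)) (A : Type) [Finite A] :
    (OperadIdeal.span P S).carrier A ≤ J.carrier A :=
  iInf₂_le J h

/-- The inverse of an isomorphism of operads. -/
def OperadIso.symm {P Q : Operad K} (φ : OperadIso P Q) : OperadIso Q P where
  equiv A _ := (φ.equiv A).symm
  map_relabel e q := by
    rw [LinearEquiv.symm_apply_eq, φ.map_relabel, LinearEquiv.apply_symm_apply]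
  map_one := by rw [LinearEquiv.symm_apply_eq, φ.map_one]
  map_comp p q := by
    rw [LinearEquiv.symm_apply_eq, φ.map_comp, LinearEquiv.apply_symm_apply,
      LinearEquiv.apply_symm_apply]

/-- The preimage of an ideal under an isomorphism. -/
def OperadIdeal.comap {P Q : Operad K} (φ : OperadIso P Q) (J : OperadIdeal Q) :
    OperadIdeal P where
  carrier A _ := (J.carrier A).comap (φ.equiv A).toLinearMap
  relabel_mem e p hp := by
    simpa [φ.map_relabel] using J.relabel_mem e hp
  comp_mem_left q hp := by
    simpa [φ.map_comp] using J.comp_mem_left (φ.equiv _ q) hp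
  comp_mem_right p q hq := by
    simpa [φ.map_comp] using J.comp_mem_right (φ.equiv _ p) hq

/-- An isomorphism of operads that exchanges two ideals induces one of the quotients. -/
def OperadIso.quotient {P Q : Operad K} (φ : OperadIso P Q) (I : OperadIdeal P)
    (J : OperadIdeal Q)
    (h : ∀ (A : Type) [Finite A], (I.carrier A).map (φ.equiv A).toLinearMap = J.carrier A) :
    OperadIso (P.quotient I) (Q.quotient J) where
  equiv A _ := Submodule.Quotient.equiv _ _ (φ.equiv A) (h A)
  map_relabel e p := by
    obtain ⟨p, rfl⟩ := Submodule.Quotient.mk_surjective _ p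
    exact congrArg Submodule.Quotient.mk (φ.map_relabel e p)
  map_one := congrArg Submodule.Quotient.mk φ.map_one
  map_comp p q := by
    obtain ⟨p, rfl⟩ := Submodule.Quotient.mk_surjective _ p
    obtain ⟨q, rfl⟩ := Submodule.Quotient.mk_surjective _ q
    exact congrArg Submodule.Quotient.mk (φ.map_comp p q)

/-- The preimage of an ideal is an ideal, so minimality of the span reduces each inclusion to
generators: one along `φ`, the other along `φ.symm`. -/
theorem OperadIso.map_span_eq {P Q : Operad K} (φ : OperadIso P Q)
    {S : ∀ n : ℕ, Set (P.obj (Fin n))} {T : ∀ n : ℕ, Set (Q.obj (Fin n))}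
    (hST : ∀ n, ∀ p ∈ S n, φ.equiv (Fin n) p ∈ (OperadIdeal.span Q T).carrier (Fin n))
    (hTS : ∀ n, ∀ q ∈ T n, (φ.equiv (Fin n)).symm q ∈ (OperadIdeal.span P S).carrier (Fin n))
    (A : Type) [Finite A] :
    ((OperadIdeal.span P S).carrier A).map (φ.equiv A).toLinearMap =
      (OperadIdeal.span Q T).carrier A := by
  apply le_antisymm
  · rw [Submodule.map_le_iff_le_comap]
    exact OperadIdeal.span_le (J := (OperadIdeal.span Q T).comap φ) (fun n p hp => hST n p hp) A
  · intro q hq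
    refine ⟨(φ.equiv A).symm q, ?_, by simp⟩
    exact OperadIdeal.span_le (J := (OperadIdeal.span P S).comap φ.symm)
      (fun n p hp => hTS n p hp) A hq

/-! ### Change of decorations -/

namespace BTree

variable {X Y Z : Type u} {A B : Type}

/-- Apply a function to the decorations of the vertices. -/
def mapDec (f : X → Y) : BTree X A → BTree Y A
  | leaf a => leaf a
  | node x l r => node (f x) (mapDec f l) (mapDec f r)

theorem leaves_mapDec (f : X → Y) (t : BTree X A) : (t.mapDec f).leaves = t.leaves := by
  induction t with
  | leaf a => rfl
  | node x l r hl hr => simp [mapDec, leaves, hl, hr]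

theorem mapDec_subst (f : X → Y) (g : A → BTree X B) (t : BTree X A) :
    (t.subst g).mapDec f = (t.mapDec f).subst (fun a => (g a).mapDec f) := by
  induction t with
  | leaf a => rfl
  | node x l r hl hr => simp [mapDec, subst, hl, hr]

theorem mapDec_mapDec (f : X → Y) (g : Y → Z) (t : BTree X A) :
    (t.mapDec f).mapDec g = t.mapDec (g ∘ f) := by
  induction t with
  | leaf a => rfl
  | node x l r hl hr => simp [mapDec, hl, hr]

theorem mapDec_id (t : BTree X A) : t.mapDec id = t := by
  induction t with
  | leaf a => rfl
  | node x l r hl hr => simp [mapDec, hl, hr]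

theorem isMultilinear_mapDec (f : X → Y) (t : BTree X A) :
    (t.mapDec f).IsMultilinear ↔ t.IsMultilinear := by
  simp [IsMultilinear, leaves_mapDec]

end BTree

namespace MTree

variable {X Y : Type u} {A B : Type}

/-- Apply a function to the decorations of the vertices. -/
def mapDec (f : X → Y) (t : MTree X A) : MTree Y A :=
  ⟨t.1.mapDec f, (BTree.isMultilinear_mapDec f t.1).2 t.2⟩

theorem mapDec_relabel (f : X → Y) (e : A ≃ B) (t : MTree X A) :
    (t.relabel e).mapDec f = (t.mapDec f).relabel e :=
  MTree.ext (by simp [mapDec, relabel, BTree.map, BTree.mapDec_subst, BTree.mapDec])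

theorem mapDec_graft (f : X → Y) (t : MTree X (Option A)) (s : MTree X B) :
    (t.graft s).mapDec f = (t.mapDec f).graft (s.mapDec f) := by
  apply MTree.ext
  simp only [mapDec, graft, BTree.graft, BTree.map, BTree.mapDec_subst]
  congr 1
  funext o
  cases o <;> simp [BTree.mapDec_subst, BTree.mapDec]

/-- A bijection of decorations gives a bijection of trees. -/
def congrDec (f : X ≃ Y) (A : Type) : MTree X A ≃ MTree Y A where
  toFun := mapDec f
  invFun := mapDec f.symm
  left_inv t := MTree.ext (by simp [mapDec, BTree.mapDec_mapDec, BTree.mapDec_id])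
  right_inv t := MTree.ext (by simp [mapDec, BTree.mapDec_mapDec, BTree.mapDec_id])

end MTree

/-- A bijection of the generating sets gives an isomorphism of free operads. -/
def freeOperadCongr (K : Type u) [Field K] {X Y : Type u} (f : X ≃ Y) :
    OperadIso (freeOperad K X) (freeOperad K Y) where
  equiv A _ := Finsupp.domLCongr (MTree.congrDec f A)
  map_relabel {A B _ _} e p := by
    refine finsupp_ext
      ((Finsupp.domLCongr (MTree.congrDec f B)).toLinearMap ∘ₗ
        Finsupp.lmapDomain K K (MTree.relabel e))
      (Finsupp.lmapDomain K K (MTree.relabel e) ∘ₗ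
        (Finsupp.domLCongr (R := K) (MTree.congrDec f A)).toLinearMap) (fun t => ?_) p
    simp [MTree.congrDec, MTree.mapDec_relabel]
  map_one := Finsupp.domLCongr_single _ _ _
  map_comp {A B _ _} p q := by
    change (MTree X (Option A) →₀ K) at p
    change (MTree X B →₀ K) at q
    change Finsupp.domLCongr (R := K) (MTree.congrDec f (A ⊕ B)) (freeComp K X A B p q) =
      freeComp K Y A B (Finsupp.domLCongr (R := K) (MTree.congrDec f _) p)
        (Finsupp.domLCongr (R := K) (MTree.congrDec f _) q)
    induction p using Finsupp.induction_linear with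
    | zero => simp
    | add p p' hp hp' => simp only [map_add, LinearMap.add_apply, hp, hp']
    | single t a =>
      induction q using Finsupp.induction_linear with
      | zero => simp
      | add q q' hq hq' => simp only [map_add, hq, hq']
      | single s b =>
        simp [-Finsupp.single_mul, freeComp_single, MTree.congrDec, MTree.mapDec_graft]

/-! ### Monomials under change of decorations and relabelling -/

theorem ofTree_of_isMultilinear (K : Type u) [Field K] {X : Type u} {A : Type} {t : BTree X A}
    (h : t.IsMultilinear) : ofTree K t = Finsupp.single ⟨t, h⟩ 1 :=
  dif_pos h

/-- Multilinearity ignores decorations, so the default value 0 of `ofTree` occurs on both sides at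
once. -/
theorem freeOperadCongr_ofTree {X Y : Type u} (f : X ≃ Y) {A : Type} [Finite A]
    (t : BTree X A) :
    (freeOperadCongr K f).equiv A (ofTree K t) = ofTree K (t.mapDec f) := by
  by_cases h : t.IsMultilinear
  · rw [ofTree_of_isMultilinear K h,
      ofTree_of_isMultilinear K ((BTree.isMultilinear_mapDec f t).2 h)]
    exact Finsupp.domLCongr_single _ _ _
  · rw [ofTree, dif_neg h, ofTree, dif_neg (by rwa [BTree.isMultilinear_mapDec])]
    exact map_zero _

theorem freeOperadCongr_symm_ofTree {X Y : Type u} (f : X ≃ Y) {A : Type} [Finite A]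
    (t : BTree Y A) :
    ((freeOperadCongr K f).equiv A).symm (ofTree K t) = ofTree K (t.mapDec f.symm) := by
  refine (LinearEquiv.symm_apply_eq _).2 ?_
  rw [freeOperadCongr_ofTree, BTree.mapDec_mapDec, f.self_comp_symm, BTree.mapDec_id]

theorem mapDomain_relabel_ofTree {X : Type u} {A B : Type} (e : A ≃ B) (t : BTree X A) :
    (ofTree K t).mapDomain (MTree.relabel e) = ofTree K (t.map e) := by
  by_cases h : t.IsMultilinear
  · rw [ofTree_of_isMultilinear K h, ofTree_of_isMultilinear K (h.map e),
      Finsupp.mapDomain_single]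
    rfl
  · have h' : ¬ (t.map e).IsMultilinear := fun h' => h (by
      have := h'.map e.symm
      simpa [BTree.map, BTree.subst_subst, BTree.subst, BTree.subst_leaf] using this)
    rw [ofTree, dif_neg h, ofTree, dif_neg h', Finsupp.mapDomain_zero]

/-! ### Isomorphic quadratic data -/

namespace QuadraticData

/-- Isomorphic binary quadratic data define isomorphic operads. -/
def operadCongr (D D' : QuadraticData K) (θ : D.E ≃ₗ[K] D'.E)
    (hθ : ∀ e, θ (D.swap e) = D'.swap (θ e))
    (h : ∀ r ∈ D.rel,
      (freeOperadCongr K θ.toEquiv).equiv (Fin 3) r ∈ D'.ideal.carrier (Fin 3))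
    (h' : ∀ r ∈ D'.rel,
      ((freeOperadCongr K θ.toEquiv).equiv (Fin 3)).symm r ∈ D.ideal.carrier (Fin 3)) :
    OperadIso D.operad D'.operad :=
  (freeOperadCongr K θ.toEquiv).quotient D.ideal D'.ideal <| by
    have mono (e : D.E) (i j : Fin 2) :
        (freeOperadCongr K θ.toEquiv).equiv (Fin 2) (mono2 K e i j) = mono2 K (θ e) i j :=
      freeOperadCongr_ofTree _ _
    have mono' (e : D'.E) (i j : Fin 2) :
        ((freeOperadCongr K θ.toEquiv).equiv (Fin 2)).symm (mono2 K e i j) =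
          mono2 K (θ.symm e) i j :=
      freeOperadCongr_symm_ofTree _ _
    have hθ' (e : D'.E) : θ.symm (D'.swap e) = D.swap (θ.symm e) := by
      rw [LinearEquiv.symm_apply_eq, hθ, LinearEquiv.apply_symm_apply]
    intro A _
    refine OperadIso.map_span_eq _ ?_ ?_ A
    -- As `θ` is linear and equivariant, an arity-two relation goes to the relation of the same kind
    -- on the images; arity three is the hypothesis.
    · rintro n p (⟨e, f⟩ | ⟨c, e⟩ | ⟨e⟩ | ⟨r, hp⟩)
      · refine OperadIdeal.subset_span _ _ 2 ?_
        have := Relation.add (D := D') (θ e) (θ f)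
        rw [← map_add] at this
        erw [map_sub, map_add]
        simp only [mono]
        exact this
      · refine OperadIdeal.subset_span _ _ 2 ?_
        have := Relation.smul (D := D') c (θ e)
        rw [← map_smul] at this
        erw [map_sub, map_smul]
        simp only [mono]
        exact this
      · refine OperadIdeal.subset_span _ _ 2 ?_
        have := Relation.swap (D := D') (θ e)
        rw [← hθ] at this
        erw [map_sub]
        simp only [mono]
        exact this
      · exact h _ hp
    · rintro n p (⟨e, f⟩ | ⟨c, e⟩ | ⟨e⟩ | ⟨r, hp⟩)
      · refine OperadIdeal.subset_span _ _ 2 ?_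
        have := Relation.add (D := D) (θ.symm e) (θ.symm f)
        rw [← map_add] at this
        erw [map_sub, map_add]
        simp only [mono']
        exact this
      · refine OperadIdeal.subset_span _ _ 2 ?_
        have := Relation.smul (D := D) c (θ.symm e)
        rw [← map_smul] at this
        erw [map_sub, map_smul]
        simp only [mono']
        exact this
      · refine OperadIdeal.subset_span _ _ 2 ?_
        have := Relation.swap (D := D) (θ.symm e)
        rw [← hθ'] at this
        erw [map_sub]
        simp only [mono']
        exact this
      · exact h' _ hp

theorem operadCongr_gen (D D' : QuadraticData K) (θ : D.E ≃ₗ[K] D'.E)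
    (hθ : ∀ e, θ (D.swap e) = D'.swap (θ e))
    (h : ∀ r ∈ D.rel,
      (freeOperadCongr K θ.toEquiv).equiv (Fin 3) r ∈ D'.ideal.carrier (Fin 3))
    (h' : ∀ r ∈ D'.rel,
      ((freeOperadCongr K θ.toEquiv).equiv (Fin 3)).symm r ∈ D.ideal.carrier (Fin 3))
    (e : D.E) : (operadCongr D D' θ hθ h h').equiv (Fin 2) (D.gen e) = D'.gen (θ e) :=
  congrArg Submodule.Quotient.mk (freeOperadCongr_ofTree θ.toEquiv _)

end QuadraticData

/-! ### Normal forms in arity three -/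

namespace BTree

variable {X : Type u} {A : Type}

theorem leaves_length_pos (t : BTree X A) : 0 < t.leaves.length := by
  induction t with
  | leaf a => simp [leaves]
  | node x l r hl hr => simp only [leaves, List.length_append]; omega

theorem IsMultilinear.length_leaves {n : ℕ} {t : BTree X (Fin n)} (h : t.IsMultilinear) :
    t.leaves.length = n := by
  have : t.leaves.toFinset = Finset.univ := by ext a; simp [h.2 a]
  rw [← List.toFinset_card_of_nodup h.1, this, Finset.card_univ, Fintype.card_fin]

/-- A multilinear tree with three leaves has one of the two shapes of such trees. -/
theorem IsMultilinear.eq_node_of_fin_three {t : BTree X (Fin 3)} (h : t.IsMultilinear) :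
    ∃ (f e : X) (i j k : Fin 3), i ≠ j ∧ i ≠ k ∧ j ≠ k ∧
      (t = .node f (.node e (.leaf i) (.leaf j)) (.leaf k) ∨
        t = .node f (.leaf k) (.node e (.leaf i) (.leaf j))) := by
  have hn := h.length_leaves
  have hd := h.1
  -- Every subtree has at least one leaf, so counting leaves leaves only two shapes, each with one
  -- subtree still to be identified as a leaf.
  rcases t with a | ⟨f, (a | ⟨e, (a | ⟨_, a, b⟩), c⟩), (d | ⟨g, (d | ⟨_, d, d'⟩), d''⟩)⟩
  all_goals simp only [leaves, List.length_append, List.length_cons, List.length_nil] at hn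
  all_goals try have := leaves_length_pos a
  all_goals try have := leaves_length_pos b
  all_goals try have := leaves_length_pos c
  all_goals try have := leaves_length_pos d
  all_goals try have := leaves_length_pos d'
  all_goals try have := leaves_length_pos d''
  all_goals try omega
  · rcases d'' with b | ⟨_, b, c⟩
    · refine ⟨f, g, d, b, a, ?_, ?_, ?_, Or.inr rfl⟩ <;> rintro rfl <;> simp [leaves] at hd
    · have := leaves_length_pos b
      have := leaves_length_pos c
      simp only [leaves, List.length_append] at hn
      omega
  · rcases c with b | ⟨_, b, c⟩
    · refine ⟨f, e, a, b, d, ?_, ?_, ?_, Or.inl rfl⟩ <;> rintro rfl <;> simp [leaves] at hd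
    · have := leaves_length_pos b
      have := leaves_length_pos c
      simp only [leaves, List.length_append] at hn
      omega

end BTree

/-- The bijection that marks the first of two inputs. -/
def markFirst : Fin 2 ≃ Option Unit where
  toFun i := if i = 0 then none else some ()
  invFun o := o.elim 0 (fun _ => 1)
  left_inv := by decide
  right_inv := by decide

/-- The labelling of `f(e(-, -), -)` by `k + 1, k + 2, k`. -/
def cyclicLabel (k : Fin 3) : Unit ⊕ Fin 2 ≃ Fin 3 :=
  Equiv.ofBijective (Sum.elim (fun _ => k) (fun i => k + 1 + i.castSucc))
    (by revert k; decide)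

/-! ### Classes of trees and the pairing in arity three -/

namespace QuadraticData

variable (D : QuadraticData K)

/-- The projection from the free operad. -/
def proj (A : Type) [Finite A] : (MTree D.E A →₀ K) →ₗ[K] D.operad.obj A :=
  (D.ideal.carrier A).mkQ

theorem proj_eq_zero_iff {A : Type} [Finite A] (x : MTree D.E A →₀ K) :
    D.proj A x = 0 ↔ x ∈ D.ideal.carrier A :=
  Submodule.Quotient.mk_eq_zero _

theorem proj_eq_zero_of_relation {n : ℕ} {r : MTree D.E (Fin n) →₀ K} (h : D.Relation n r) :
    D.proj (Fin n) r = 0 :=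
  (D.proj_eq_zero_iff r).2 (OperadIdeal.subset_span _ _ n h)

theorem proj_mapDomain_relabel {A B : Type} [Finite A] [Finite B] (e : A ≃ B)
    (x : MTree D.E A →₀ K) :
    D.proj B (x.mapDomain (MTree.relabel e)) = D.operad.relabel e (D.proj A x) :=
  rfl

/-- The operations given by elements of `E`, as a linear map. -/
def genₗ : D.E →ₗ[K] D.operad.obj (Fin 2) where
  toFun := D.gen
  map_add' e f := by
    have := D.proj_eq_zero_of_relation (.add e f)
    rwa [map_sub, map_add, sub_eq_zero] at this
  map_smul' c e := by
    have := D.proj_eq_zero_of_relation (.smul c e)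
    rwa [map_sub, map_smul, sub_eq_zero] at this

theorem proj_mono2 (e : D.E) : D.proj (Fin 2) (mono2 K e 0 1) = D.genₗ e := rfl

theorem proj_mono2_swap (e : D.E) : D.proj (Fin 2) (mono2 K e 1 0) = D.genₗ (D.swap e) := by
  have := D.proj_eq_zero_of_relation (.swap e)
  rw [map_sub, sub_eq_zero] at this
  exact this.symm

/-- The composite `p(q(k + 1, k + 2), k)`. -/
def cyclicComp (k : Fin 3) :
    D.operad.obj (Fin 2) →ₗ[K] D.operad.obj (Fin 2) →ₗ[K] D.operad.obj (Fin 3) :=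
  (D.operad.comp.compr₂ (D.operad.relabel (cyclicLabel k))) ∘ₗ D.operad.relabel markFirst

theorem cyclicComp_proj_ofTree (k : Fin 3) {t s : BTree D.E (Fin 2)} (ht : t.IsMultilinear)
    (hs : s.IsMultilinear) :
    D.cyclicComp k (D.proj _ (ofTree K t)) (D.proj _ (ofTree K s)) =
      D.proj _ (ofTree K (((t.map markFirst).graft s).map (cyclicLabel k))) := by
  rw [← mapDomain_relabel_ofTree, ofTree_of_isMultilinear K ((ht.map _).graft hs),
    ofTree_of_isMultilinear K ht, ofTree_of_isMultilinear K hs]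
  -- Once the monomial is displayed as a composite of representatives, both sides agree by
  -- definition of the quotient operad.
  have : Finsupp.single (⟨(t.map markFirst).graft s, (ht.map _).graft hs⟩ : MTree D.E _) (1 : K) =
      freeComp K D.E Unit (Fin 2)
        ((Finsupp.single ⟨t, ht⟩ 1).mapDomain (MTree.relabel markFirst))
        (Finsupp.single ⟨s, hs⟩ 1) := by
    rw [Finsupp.mapDomain_single, freeComp_single, mul_one]
    rfl
  rw [this]
  rfl

theorem isMultilinear_node_fin_two {X : Type u} (x : X) {i j : Fin 2} (h : i ≠ j) :
    (BTree.node x (.leaf i) (.leaf j)).IsMultilinear := by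
  revert i j
  simp only [BTree.IsMultilinear, BTree.leaves]
  decide

/-- A tree with three leaves is determined in `P(E, R)` by its normal form. -/
theorem exists_normalForm_eq (t : MTree D.E (Fin 3)) :
    ∃ k f e, normalForm D.swap t.tree = some (k, f, e) ∧
      D.proj (Fin 3) (Finsupp.single t 1) = D.cyclicComp k (D.genₗ f) (D.genₗ e) := by
  obtain ⟨t, ht⟩ := t
  rw [← ofTree_of_isMultilinear K ht]
  obtain ⟨f, e, i, j, k, hij, hik, hjk, h | h⟩ := ht.eq_node_of_fin_three
  · refine ⟨k, f, if j = i + 1 then e else D.swap e, by simp only [h]; rfl, ?_⟩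
    rw [h, ← proj_mono2 D f]
    split_ifs with hj
    · rw [← proj_mono2, mono2, mono2,
        D.cyclicComp_proj_ofTree k (isMultilinear_node_fin_two f (by decide))
          (isMultilinear_node_fin_two e (by decide))]
      obtain rfl : i = k + 1 := by omega
      obtain rfl : j = k + 2 := by omega
      fin_cases k <;> rfl
    -- Here the inner leaves are in anticyclic order; the opposite monomial of `e` represents `swap
    -- e` and restores the original tree after the cyclic labelling.
    · rw [← proj_mono2_swap, mono2, mono2,
        D.cyclicComp_proj_ofTree k (isMultilinear_node_fin_two f (by decide))
          (isMultilinear_node_fin_two e (by decide))]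
      obtain rfl : j = k + 1 := by omega
      obtain rfl : i = k + 2 := by omega
      fin_cases k <;> rfl
  · refine ⟨k, D.swap f, if j = i + 1 then e else D.swap e, by simp only [h]; rfl, ?_⟩
    -- In the opposite monomial of `f` the marked input 0 is on the right, which is where the inner
    -- vertex has to be grafted.
    rw [h, ← proj_mono2_swap D f]
    split_ifs with hj
    · rw [← proj_mono2, mono2, mono2,
        D.cyclicComp_proj_ofTree k (isMultilinear_node_fin_two f (by decide))
          (isMultilinear_node_fin_two e (by decide))]
      obtain rfl : i = k + 1 := by omega
      obtain rfl : j = k + 2 := by omega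
      fin_cases k <;> rfl
    · rw [← proj_mono2_swap, mono2, mono2,
        D.cyclicComp_proj_ofTree k (isMultilinear_node_fin_two f (by decide))
          (isMultilinear_node_fin_two e (by decide))]
      obtain rfl : j = k + 1 := by omega
      obtain rfl : i = k + 2 := by omega
      fin_cases k <;> rfl

/-- The normal form touches decorations only through the swap, so it is natural for maps that
intertwine the swaps. -/
theorem normalForm_mapDec {X Y : Type u} {σ : X → X} {τ : Y → Y} (θ : X → Y)
    (h : ∀ x, θ (σ x) = τ (θ x)) {t : BTree X (Fin 3)} {k : Fin 3} {f e : X}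
    (ht : normalForm σ t = some (k, f, e)) :
    normalForm τ (t.mapDec θ) = some (k, θ f, θ e) := by
  unfold normalForm at ht
  split at ht <;> simp only [Option.some.injEq, Prod.mk.injEq, reduceCtorEq] at ht
  all_goals
    obtain ⟨rfl, rfl, rfl⟩ := ht
    simp only [BTree.mapDec, normalForm, apply_ite θ, h]

/-- The pairing as a bilinear map. -/
def pairingₗ :
    (MTree (Module.Dual K D.E) (Fin 3) →₀ K) →ₗ[K] (MTree D.E (Fin 3) →₀ K) →ₗ[K] K :=
  Finsupp.linearCombination K fun s =>
    Finsupp.linearCombination K fun t => D.pairTree s.tree t.tree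

theorem pairing_eq_pairingₗ (x : MTree (Module.Dual K D.E) (Fin 3) →₀ K)
    (y : MTree D.E (Fin 3) →₀ K) : D.pairing x y = D.pairingₗ x y := by
  simp [pairing, pairingₗ, Finsupp.linearCombination_apply, Finsupp.sum, Finset.mul_sum,
    mul_assoc, LinearMap.sum_apply]

theorem pairingₗ_single (s : MTree (Module.Dual K D.E) (Fin 3)) (t : MTree D.E (Fin 3)) :
    D.pairingₗ (Finsupp.single s 1) (Finsupp.single t 1) = D.pairTree s.tree t.tree := by
  simp [pairingₗ, Finsupp.linearCombination_single]

theorem pairTree_eq {s : BTree (Module.Dual K D.E) (Fin 3)} {t : BTree D.E (Fin 3)}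
    {k k' : Fin 3} {φ ε : Module.Dual K D.E} {f e : D.E}
    (hs : normalForm (fun φ : Module.Dual K D.E => -(φ ∘ₗ D.swap)) s = some (k, φ, ε))
    (ht : normalForm D.swap t = some (k', f, e)) :
    D.pairTree s t = if k = k' then φ f * ε e else 0 := by
  rw [pairTree, hs, ht]

end QuadraticData

/-! ### One product without symmetry -/

/-- The isomorphism of `S_2`-modules from `K[S_2]^∨` to `K[S_2]` that sends the coordinate
functional of the generator to the generator. -/
def dualRegular (K : Type u) [Field K] : Module.Dual K (K × K) ≃ₗ[K] K × K where
  toFun φ := (φ (1, 0), -φ (0, 1))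
  invFun v := v.1 • LinearMap.fst K K K - v.2 • LinearMap.snd K K K
  map_add' φ ψ := by simp [add_comm]
  map_smul' c φ := by simp
  left_inv φ := by ext <;> simp
  right_inv v := by simp

theorem dualRegular_fst : dualRegular K (LinearMap.fst K K K) = mu K := by
  simp [dualRegular, mu]

theorem dualRegular_symm_mu : (dualRegular K).symm (mu K) = LinearMap.fst K K K := by
  rw [LinearEquiv.symm_apply_eq, dualRegular_fst]

/-- The two signs, from sgn in E^∨ and from `dualRegular`, cancel in the second coordinate and
coincide in the first. -/
theorem dualRegular_swap (R R' : Set (MTree (K × K) (Fin 3) →₀ K))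
    (φ : (oneProduct K R).koszulDual.E) :
    dualRegular K ((oneProduct K R).koszulDual.swap φ) =
      (oneProduct K R').swap (dualRegular K φ) := by
  refine Prod.ext ?_ ?_
  · rfl
  · exact neg_neg ((show Module.Dual K (K × K) from φ) (1, 0))

/-- The word `(x_i x_j) x_k` in the operation `x`. -/
def ltree {X : Type u} (x : X) (i j k : Fin 3) : BTree X (Fin 3) :=
  .node x (.node x (.leaf i) (.leaf j)) (.leaf k)

/-- The word `x_i (x_j x_k)` in the operation `x`. -/
def rtree {X : Type u} (x : X) (i j k : Fin 3) : BTree X (Fin 3) :=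
  .node x (.leaf i) (.node x (.leaf j) (.leaf k))

section

variable {X : Type u} (x : X) {i j k : Fin 3}

theorem isMultilinear_ltree (hij : i ≠ j) (hik : i ≠ k) (hjk : j ≠ k) :
    (ltree x i j k).IsMultilinear := by
  simp only [ltree, BTree.IsMultilinear, BTree.leaves]
  revert i j k
  decide

theorem isMultilinear_rtree (hij : i ≠ j) (hik : i ≠ k) (hjk : j ≠ k) :
    (rtree x i j k).IsMultilinear := by
  simp only [rtree, BTree.IsMultilinear, BTree.leaves]
  revert i j k
  decide

end

/-- The sign of the permutation `0, 1, 2 ↦ i, j, k`, for distinct `i, j, k`. -/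
def sgn (K : Type u) [Field K] (i j : Fin 3) : K := if j = i + 1 then 1 else -1

theorem lword_eq (i j k : Fin 3) : lword K i j k = ofTree K (ltree (mu K) i j k) := rfl

theorem rword_eq (i j k : Fin 3) : rword K i j k = ofTree K (rtree (mu K) i j k) := rfl

/-- The transposition of the regular representation. -/
def regularSwap (K : Type u) [Field K] : K × K →ₗ[K] K × K :=
  LinearMap.prod (LinearMap.snd K K K) (LinearMap.fst K K K)

/-! ### The table of pairings between words -/

section

variable (R : Set (MTree (K × K) (Fin 3) →₀ K)) {i j k i' j' k' : Fin 3}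

/-- The pairing for an operad generated by one product. -/
def onePairing :
    (MTree (Module.Dual K (K × K)) (Fin 3) →₀ K) →ₗ[K] (MTree (K × K) (Fin 3) →₀ K) →ₗ[K] K :=
  (oneProduct K R).pairingₗ

theorem mem_koszulDual_rel {x : MTree (Module.Dual K (K × K)) (Fin 3) →₀ K} :
    x ∈ (oneProduct K R).koszulDual.rel ↔ ∀ r ∈ R, ∀ σ : Equiv.Perm (Fin 3),
      onePairing R x (Finsupp.lmapDomain K K (MTree.relabel σ) r) = 0 :=
  forall₃_congr fun _ _ _ =>
    iff_of_eq (congrArg (· = 0) ((oneProduct K R).pairing_eq_pairingₗ x _))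

theorem onePairing_single {s : MTree (Module.Dual K (K × K)) (Fin 3)}
    {t : BTree (K × K) (Fin 3)} (ht : t.IsMultilinear)
    {k k' : Fin 3} {φ ε : Module.Dual K (K × K)} {f e : K × K}
    (hns : QuadraticData.normalForm
      (fun φ : Module.Dual K (K × K) => -(φ ∘ₗ regularSwap K)) s.tree = some (k, φ, ε))
    (hnt : QuadraticData.normalForm (regularSwap K) t = some (k', f, e)) :
    onePairing R (Finsupp.single s 1) (ofTree K t) = if k = k' then φ f * ε e else 0 := by
  rw [ofTree_of_isMultilinear K ht]
  exact ((oneProduct K R).pairingₗ_single _ _).trans ((oneProduct K R).pairTree_eq hns hnt)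

/-- Reordering the inner leaves cyclically costs the sign of E^∨ exactly when i, j, k is anticyclic.
If the inner leaves come in opposite orders, a coordinate functional meets the other basis vector
and gives 0. -/
theorem onePairing_ltree_lword (hij : i ≠ j) (hik : i ≠ k) (hjk : j ≠ k)
    (hij' : i' ≠ j') (hik' : i' ≠ k') (hjk' : j' ≠ k') :
    onePairing R (ofTree K (ltree (LinearMap.fst K K K) i j k)) (lword K i' j' k') =
      if i = i' ∧ j = j' then sgn K i j else 0 := by
  rw [ofTree_of_isMultilinear K (isMultilinear_ltree _ hij hik hjk), lword_eq,
    onePairing_single R (isMultilinear_ltree (mu K) hij' hik' hjk') rfl rfl]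
  split_ifs <;> first | omega | simp [regularSwap, mu, sgn, *]

/-- Compared with left words, moving the outer leaf to the right applies the swap of E^∨ once more;
this is the extra minus sign. -/
theorem onePairing_rtree_rword (hij : i ≠ j) (hik : i ≠ k) (hjk : j ≠ k)
    (hij' : i' ≠ j') (hik' : i' ≠ k') (hjk' : j' ≠ k') :
    onePairing R (ofTree K (rtree (LinearMap.fst K K K) i j k)) (rword K i' j' k') =
      if i = i' ∧ j = j' then -sgn K i j else 0 := by
  rw [ofTree_of_isMultilinear K (isMultilinear_rtree _ hij hik hjk), rword_eq,
    onePairing_single R (isMultilinear_rtree (mu K) hij' hik' hjk') rfl rfl]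
  -- The normal form tests the inner pair `j, k`, whereas `sgn` tests `i, j`; for distinct indices
  -- mod 3 the conditions agree.
  have h : j = i + 1 ↔ k = j + 1 := by omega
  simp only [sgn, h]
  split_ifs <;> first | omega | simp [regularSwap, mu, *]

/-- The outer decorations already pair to zero: the first coordinate is evaluated on the swapped
generator. -/
theorem onePairing_ltree_rword (hij : i ≠ j) (hik : i ≠ k) (hjk : j ≠ k)
    (hij' : i' ≠ j') (hik' : i' ≠ k') (hjk' : j' ≠ k') :
    onePairing R (ofTree K (ltree (LinearMap.fst K K K) i j k)) (rword K i' j' k') = 0 := by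
  rw [ofTree_of_isMultilinear K (isMultilinear_ltree _ hij hik hjk), rword_eq,
    onePairing_single R (isMultilinear_rtree (mu K) hij' hik' hjk') rfl rfl]
  simp [regularSwap, mu]

theorem onePairing_rtree_lword (hij : i ≠ j) (hik : i ≠ k) (hjk : j ≠ k)
    (hij' : i' ≠ j') (hik' : i' ≠ k') (hjk' : j' ≠ k') :
    onePairing R (ofTree K (rtree (LinearMap.fst K K K) i j k)) (lword K i' j' k') = 0 := by
  rw [ofTree_of_isMultilinear K (isMultilinear_rtree _ hij hik hjk), lword_eq,
    onePairing_single R (isMultilinear_ltree (mu K) hij' hik' hjk') rfl rfl]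
  simp [regularSwap, mu]

end

theorem relabel_lword (σ : Equiv.Perm (Fin 3)) (i j k : Fin 3) :
    Finsupp.lmapDomain K K (MTree.relabel σ) (lword K i j k) = lword K (σ i) (σ j) (σ k) :=
  mapDomain_relabel_ofTree _ _

theorem relabel_rword (σ : Equiv.Perm (Fin 3)) (i j k : Fin 3) :
    Finsupp.lmapDomain K K (MTree.relabel σ) (rword K i j k) = rword K (σ i) (σ j) (σ k) :=
  mapDomain_relabel_ofTree _ _

/-- The linear bijection of free operads in arity three induced by `dualRegular`. -/
def dualRegularTree (K : Type u) [Field K] :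
    (MTree (Module.Dual K (K × K)) (Fin 3) →₀ K) ≃ₗ[K] (MTree (K × K) (Fin 3) →₀ K) :=
  (freeOperadCongr K (dualRegular K).toEquiv).equiv (Fin 3)

theorem dualRegularTree_single (t : MTree (Module.Dual K (K × K)) (Fin 3)) :
    dualRegularTree K (Finsupp.single t 1) = Finsupp.single (t.mapDec (dualRegular K)) 1 :=
  Finsupp.domLCongr_single _ _ _

theorem dualRegularTree_symm_lword (i j k : Fin 3) :
    (dualRegularTree K).symm (lword K i j k) =
      ofTree K (ltree (LinearMap.fst K K K) i j k) := by
  rw [← dualRegular_symm_mu]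
  exact freeOperadCongr_symm_ofTree _ _

theorem dualRegularTree_symm_rword (i j k : Fin 3) :
    (dualRegularTree K).symm (rword K i j k) =
      ofTree K (rtree (LinearMap.fst K K K) i j k) := by
  rw [← dualRegular_symm_mu]
  exact freeOperadCongr_symm_ofTree _ _

/-! ### Expansion in words modulo the arity-two relations -/

section

variable (R R' : Set (MTree (K × K) (Fin 3) →₀ K))

/-- The projection from the free operad to an operad generated by one product, in arity three. -/
def oneProj :
    (MTree (K × K) (Fin 3) →₀ K) →ₗ[K] (oneProduct K R).operad.obj (Fin 3) :=
  (oneProduct K R).proj (Fin 3)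

/-- The composite `f(e(k + 1, k + 2), k)` of two operations. -/
def oneComp (k : Fin 3) :
    K × K →ₗ[K] K × K →ₗ[K] (oneProduct K R).operad.obj (Fin 3) :=
  ((oneProduct K R).cyclicComp k).compl₁₂ (oneProduct K R).genₗ (oneProduct K R).genₗ

theorem oneProj_single {t : MTree (K × K) (Fin 3)} {k : Fin 3} {f e : K × K}
    (h : QuadraticData.normalForm (regularSwap K) t.tree = some (k, f, e)) :
    oneProj R (Finsupp.single t 1) = oneComp R k f e := by
  obtain ⟨k', f', e', h', ht⟩ := (oneProduct K R).exists_normalForm_eq t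
  obtain ⟨rfl, rfl, rfl⟩ : k = k' ∧ f = f' ∧ e = e' := by
    have := h.symm.trans h'
    obtain ⟨h₁, h₂⟩ := Prod.mk.inj (Option.some.inj this)
    exact ⟨h₁, Prod.mk.inj h₂⟩
  exact ht

theorem oneProj_ofTree {t : BTree (K × K) (Fin 3)} (ht : t.IsMultilinear) {k : Fin 3}
    {f e : K × K} (h : QuadraticData.normalForm (regularSwap K) t = some (k, f, e)) :
    oneProj R (ofTree K t) = oneComp R k f e := by
  rw [ofTree_of_isMultilinear K ht]
  exact oneProj_single R h

theorem oneProj_relabel_eq_zero {r : MTree (K × K) (Fin 3) →₀ K} (hr : r ∈ R)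
    (σ : Equiv.Perm (Fin 3)) : oneProj R (Finsupp.lmapDomain K K (MTree.relabel σ) r) = 0 := by
  have h := (oneProduct K R).proj_eq_zero_of_relation (.rel r hr)
  exact ((oneProduct K R).proj_mapDomain_relabel σ r).trans (by rw [h, map_zero])

/-- If the normal form of `s` is (k, φ, ε), bilinearity expands the composite of θφ and θε at `k`
into four words, whose coefficients are the pairings up to the signs in θ. -/
theorem oneProj_dualRegularTree_single (s : MTree (Module.Dual K (K × K)) (Fin 3)) :
    oneProj R' (dualRegularTree K (Finsupp.single s 1)) =
      ∑ k : Fin 3,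
        (onePairing R (Finsupp.single s 1) (lword K (k + 1) (k + 2) k) •
            oneProj R' (lword K (k + 1) (k + 2) k) -
          onePairing R (Finsupp.single s 1) (lword K (k + 2) (k + 1) k) •
            oneProj R' (lword K (k + 2) (k + 1) k) -
          onePairing R (Finsupp.single s 1) (rword K k (k + 1) (k + 2)) •
            oneProj R' (rword K k (k + 1) (k + 2)) +
          onePairing R (Finsupp.single s 1) (rword K k (k + 2) (k + 1)) •
            oneProj R' (rword K k (k + 2) (k + 1))) := by
  have ne (k : Fin 3) : k + 1 ≠ k + 2 ∧ k + 1 ≠ k ∧ k + 2 ≠ k := by revert k; decide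
  have succ (k : Fin 3) : k + 2 = k + 1 + 1 ∧ k + 1 ≠ k + 2 + 1 := by revert k; decide
  obtain ⟨k, φ, ε, hs, -⟩ := (oneProduct K R).koszulDual.exists_normalForm_eq s
  change K × K →ₗ[K] K at φ
  change K × K →ₗ[K] K at ε
  have hs' : QuadraticData.normalForm
    (fun φ : Module.Dual K (K × K) => -(φ ∘ₗ regularSwap K)) s.tree = some (k, φ, ε) := hs
  have hθ : QuadraticData.normalForm (regularSwap K) (s.mapDec (dualRegular K)).tree =
      some (k, dualRegular K φ, dualRegular K ε) :=
    QuadraticData.normalForm_mapDec (dualRegular K) (dualRegular_swap R R') hs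
  have hl (k) := isMultilinear_ltree (mu K) (ne k).1 (ne k).2.1 (ne k).2.2
  have hl' (k) := isMultilinear_ltree (mu K) (ne k).1.symm (ne k).2.2 (ne k).2.1
  have hr (k) := isMultilinear_rtree (mu K) (ne k).2.1.symm (ne k).2.2.symm (ne k).1
  have hr' (k) := isMultilinear_rtree (mu K) (ne k).2.2.symm (ne k).2.1.symm (ne k).1.symm
  have nl (k : Fin 3) : QuadraticData.normalForm (regularSwap K)
      (ltree (mu K) (k + 1) (k + 2) k) = some (k, mu K, mu K) := by
    simp [ltree, QuadraticData.normalForm, (succ k).1]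
  have nl' (k : Fin 3) : QuadraticData.normalForm (regularSwap K)
      (ltree (mu K) (k + 2) (k + 1) k) = some (k, mu K, regularSwap K (mu K)) := by
    simp [ltree, QuadraticData.normalForm, (succ k).2]
  have nr (k : Fin 3) : QuadraticData.normalForm (regularSwap K)
      (rtree (mu K) k (k + 1) (k + 2)) = some (k, regularSwap K (mu K), mu K) := by
    simp [rtree, QuadraticData.normalForm, (succ k).1]
  have nr' (k : Fin 3) : QuadraticData.normalForm (regularSwap K)
      (rtree (mu K) k (k + 2) (k + 1)) =
        some (k, regularSwap K (mu K), regularSwap K (mu K)) := by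
    simp [rtree, QuadraticData.normalForm, (succ k).2]
  rw [dualRegularTree_single, oneProj_single R' hθ]
  have pl (k) := onePairing_single R (hl k) hs' (nl k)
  have pl' (k) := onePairing_single R (hl' k) hs' (nl' k)
  have pr (k) := onePairing_single R (hr k) hs' (nr k)
  have pr' (k) := onePairing_single R (hr' k) hs' (nr' k)
  have ql (k) := oneProj_ofTree R' (hl k) (nl k)
  have ql' (k) := oneProj_ofTree R' (hl' k) (nl' k)
  have qr (k) := oneProj_ofTree R' (hr k) (nr k)
  have qr' (k) := oneProj_ofTree R' (hr' k) (nr' k)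
  simp only [lword_eq, rword_eq, pl, pl', pr, pr', ql, ql', qr, qr']
  -- Trees with different outer leaves are orthogonal.
  rw [Finset.sum_eq_single k]
  · have hφ (φ : K × K →ₗ[K] K) : dualRegular K φ =
        φ (mu K) • mu K - φ (regularSwap K (mu K)) • regularSwap K (mu K) := by
      simp [dualRegular, mu, regularSwap]
    rw [hφ, hφ]
    simp only [if_true, map_sub, map_smul, LinearMap.sub_apply, LinearMap.smul_apply]
    module
  · intro b _ hb
    simp [hb.symm]
  · simp

/-- Expansion of an element of `T(E^∨)(3)` in words, with its values on the dual words as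
coefficients. -/
theorem oneProj_dualRegularTree_eq_sum (x : MTree (Module.Dual K (K × K)) (Fin 3) →₀ K) :
    oneProj R' (dualRegularTree K x) =
      ∑ k : Fin 3,
        (onePairing R x (lword K (k + 1) (k + 2) k) •
            oneProj R' (lword K (k + 1) (k + 2) k) -
          onePairing R x (lword K (k + 2) (k + 1) k) •
            oneProj R' (lword K (k + 2) (k + 1) k) -
          onePairing R x (rword K k (k + 1) (k + 2)) •
            oneProj R' (rword K k (k + 1) (k + 2)) +
          onePairing R x (rword K k (k + 2) (k + 1)) •
            oneProj R' (rword K k (k + 2) (k + 1))) := by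
  induction x using Finsupp.induction_linear with
  | zero => simp
  | add x y hx hy =>
    rw [map_add, map_add, hx, hy, ← Finset.sum_add_distrib]
    refine Finset.sum_congr rfl fun k _ => ?_
    simp only [map_add, LinearMap.add_apply]
    module
  | single s a =>
    rw [← mul_one a, ← smul_eq_mul, ← Finsupp.smul_single, map_smul, map_smul,
      oneProj_dualRegularTree_single R, Finset.smul_sum]
    refine Finset.sum_congr rfl fun k _ => ?_
    simp only [map_smul, LinearMap.smul_apply, smul_eq_mul]
    module

end

/-! ### Orthogonality of the two sets of relations -/

/-- The relations of initial Lie dialgebras. -/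
def diLieRel (K : Type u) [Field K] : Set (MTree (K × K) (Fin 3) →₀ K) :=
  {lword K 0 1 2 - (rword K 0 1 2 - rword K 1 0 2),
    rword K 0 1 2 - rword K 0 2 1 - rword K 1 0 2 + rword K 1 2 0 + rword K 2 0 1 - rword K 2 1 0}

/-- The relations of the left-commutative algebras that are dual to initial Lie dialgebras. -/
def leftCommRel (K : Type u) [Field K] : Set (MTree (K × K) (Fin 3) →₀ K) :=
  {rword K 2 0 1 - rword K 0 2 1,
    lword K 0 1 2 + lword K 1 0 2 - rword K 0 1 2 + rword K 0 2 1 - lword K 2 0 1 - lword K 0 2 1}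

theorem exists_perm_fin_three {i j k : Fin 3} (hij : i ≠ j) (hik : i ≠ k) (hjk : j ≠ k) :
    ∃ σ : Equiv.Perm (Fin 3), σ 0 = i ∧ σ 1 = j ∧ σ 2 = k := by
  revert i j k
  decide

section

variable {i j k : Fin 3}

theorem oneProj_leftCommRel_rword (hij : i ≠ j) (hik : i ≠ k) (hjk : j ≠ k) :
    oneProj (leftCommRel K) (rword K i j k) = oneProj (leftCommRel K) (rword K j i k) := by
  -- The relation is written with outer letter x_2, so 0, 1, 2 must go to j, k, i.
  obtain ⟨σ, rfl, rfl, rfl⟩ := exists_perm_fin_three hjk hij.symm hik.symm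
  have h := oneProj_relabel_eq_zero (leftCommRel K) (Or.inl rfl) σ
  simpa only [map_sub, relabel_rword, sub_eq_zero] using h

/-- This is S_k = S_j, where S_k = L(ijk) + L(jik) - R(ijk) and S_j = L(ikj) + L(kij) - R(ikj). -/
theorem oneProj_leftCommRel_lword (hij : i ≠ j) (hik : i ≠ k) (hjk : j ≠ k) :
    oneProj (leftCommRel K) (lword K i j k) + oneProj (leftCommRel K) (lword K j i k) -
      oneProj (leftCommRel K) (rword K i j k) + oneProj (leftCommRel K) (rword K i k j) -
      oneProj (leftCommRel K) (lword K k i j) - oneProj (leftCommRel K) (lword K i k j) = 0 := by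
  obtain ⟨σ, rfl, rfl, rfl⟩ := exists_perm_fin_three hij hik hjk
  have h := oneProj_relabel_eq_zero (leftCommRel K) (Or.inr rfl) σ
  simpa only [map_sub, map_add, relabel_rword, relabel_lword] using h

theorem onePairing_lword_of_mem {x : MTree (Module.Dual K (K × K)) (Fin 3) →₀ K}
    (hx : x ∈ (oneProduct K (diLieRel K)).koszulDual.rel)
    (hij : i ≠ j) (hik : i ≠ k) (hjk : j ≠ k) :
    onePairing (diLieRel K) x (lword K i j k) =
      onePairing (diLieRel K) x (rword K i j k) - onePairing (diLieRel K) x (rword K j i k) := by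
  obtain ⟨σ, rfl, rfl, rfl⟩ := exists_perm_fin_three hij hik hjk
  have h := (mem_koszulDual_rel _).1 hx _ (Or.inl rfl) σ
  simpa only [map_sub, relabel_rword, relabel_lword, sub_eq_zero] using h

end

/-- The orthogonal of the relations of initial Lie dialgebras is contained in the ideal of the
dual relations. -/
theorem dualRegularTree_mem_ideal {x : MTree (Module.Dual K (K × K)) (Fin 3) →₀ K}
    (hx : x ∈ (oneProduct K (diLieRel K)).koszulDual.rel) :
    dualRegularTree K x ∈ (oneProduct K (leftCommRel K)).ideal.carrier (Fin 3) := by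
  refine ((oneProduct K (leftCommRel K)).proj_eq_zero_iff _).1 ?_
  change oneProj (leftCommRel K) (dualRegularTree K x) = 0
  -- Relabelling changes this alternating sum at most by a sign, so the identity permutation
  -- suffices.
  have alt := (mem_koszulDual_rel _).1 hx _ (Or.inr rfl) 1
  simp only [map_sub, map_add, relabel_rword, Equiv.Perm.one_apply] at alt
  -- `h₁` and `h₂` compare S_1 and S_2 with S_0.
  have h₁ := oneProj_leftCommRel_lword (K := K) (i := 2) (j := 0) (k := 1)
    (by decide) (by decide) (by decide)
  have h₂ := oneProj_leftCommRel_lword (K := K) (i := 1) (j := 0) (k := 2)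
    (by decide) (by decide) (by decide)
  have r₀ : oneProj (leftCommRel K) (rword K 2 1 0) = oneProj (leftCommRel K) (rword K 1 2 0) :=
    oneProj_leftCommRel_rword (by decide) (by decide) (by decide)
  have r₁ : oneProj (leftCommRel K) (rword K 2 0 1) = oneProj (leftCommRel K) (rword K 0 2 1) :=
    oneProj_leftCommRel_rword (by decide) (by decide) (by decide)
  have r₂ : oneProj (leftCommRel K) (rword K 1 0 2) = oneProj (leftCommRel K) (rword K 0 1 2) :=
    oneProj_leftCommRel_rword (by decide) (by decide) (by decide)
  rw [oneProj_dualRegularTree_eq_sum (diLieRel K), Fin.sum_univ_three]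
  have e : (0 : Fin 3) + 1 = 1 ∧ (0 : Fin 3) + 2 = 2 ∧ (1 : Fin 3) + 1 = 2 ∧
    (1 : Fin 3) + 2 = 0 ∧ (2 : Fin 3) + 1 = 0 ∧ (2 : Fin 3) + 2 = 1 := by decide
  simp only [e]
  rw [onePairing_lword_of_mem hx (i := 1) (j := 2) (k := 0) (by decide) (by decide) (by decide),
    onePairing_lword_of_mem hx (i := 2) (j := 1) (k := 0) (by decide) (by decide) (by decide),
    onePairing_lword_of_mem hx (i := 2) (j := 0) (k := 1) (by decide) (by decide) (by decide),
    onePairing_lword_of_mem hx (i := 0) (j := 2) (k := 1) (by decide) (by decide) (by decide),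
    onePairing_lword_of_mem hx (i := 0) (j := 1) (k := 2) (by decide) (by decide) (by decide),
    onePairing_lword_of_mem hx (i := 1) (j := 0) (k := 2) (by decide) (by decide) (by decide)]
  rw [r₀, r₁, r₂]
  rw [r₁, r₀] at h₁
  rw [r₂] at h₂
  -- ∑ d_k S_k = d_1 (S_1 - S_0) + d_2 (S_2 - S_0) + (d_0 + d_1 + d_2) S_0, and `alt` is d_0 + d_1 +
  -- d_2 = 0.
  linear_combination (norm := module)
    (onePairing (diLieRel K) x (rword K 2 0 1) - onePairing (diLieRel K) x (rword K 0 2 1)) • h₁ +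
    (onePairing (diLieRel K) x (rword K 0 1 2) - onePairing (diLieRel K) x (rword K 1 0 2)) • h₂ +
    alt • (oneProj (leftCommRel K) (lword K 1 2 0) + oneProj (leftCommRel K) (lword K 2 1 0) -
      oneProj (leftCommRel K) (rword K 1 2 0))

/-- The dual relations are orthogonal to the relations of initial Lie dialgebras. -/
theorem dualRegularTree_symm_mem_rel {r : MTree (K × K) (Fin 3) →₀ K}
    (hr : r ∈ leftCommRel K) :
    (dualRegularTree K).symm r ∈ (oneProduct K (diLieRel K)).koszulDual.rel := by
  rw [mem_koszulDual_rel]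
  intro r' hr' σ
  have h01 : σ 0 ≠ σ 1 := by simp
  have h02 : σ 0 ≠ σ 2 := by simp
  have h12 : σ 1 ≠ σ 2 := by simp
  rcases hr with rfl | rfl <;> rcases hr' with rfl | rfl
  all_goals
    simp only [map_add, map_sub, dualRegularTree_symm_lword, dualRegularTree_symm_rword,
      LinearMap.add_apply, LinearMap.sub_apply, relabel_lword, relabel_rword]
    generalize σ 0 = i at *
    generalize σ 1 = j at *
    generalize σ 2 = k at *
    -- The table turns every pairing into a signed indicator; the resulting identities are checked
    -- on the six arrangements of i, j, k.
    simp [onePairing_ltree_lword, onePairing_rtree_rword, onePairing_ltree_rword,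
      onePairing_rtree_lword, h01, h02, h12, h01.symm, h02.symm, h12.symm]
    clear σ
    fin_cases i <;> fin_cases j <;> first | exact absurd rfl h01 | skip
    all_goals fin_cases k <;> first | exact absurd rfl h02 | exact absurd rfl h12 | simp [sgn]

/-- The isomorphism from the Koszul dual of initial Lie dialgebras to left-commutative algebras. -/
def koszulDualDiLieIIso (K : Type u) [Field K] :
    OperadIso (diLieI K).koszulDual.operad (leftComm K).operad :=
  QuadraticData.operadCongr (diLieI K).koszulDual (leftComm K) (dualRegular K)
    (dualRegular_swap _ _) (fun _ hr => dualRegularTree_mem_ideal hr)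
    -- R^⊥ contains every orthogonal element of the free operad, so here the images are themselves
    -- relations; in the other direction they only lie in the ideal.
    (fun _ hr => OperadIdeal.subset_span _ _ 3 (.rel _ (dualRegularTree_symm_mem_rel hr)))

end KoszulDualDiLie

end

theorem mainTheorem4 (K : Type u) [Field K] [CharZero K] :
    ∃ φ : KoszulDualDiLie.OperadIso (KoszulDualDiLie.diLieI K).koszulDual.operad
        (KoszulDualDiLie.leftComm K).operad,
      φ.equiv (Fin 2) ((KoszulDualDiLie.diLieI K).koszulDual.gen (LinearMap.fst K K K)) =
        (KoszulDualDiLie.leftComm K).gen (KoszulDualDiLie.mu K) :=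
  ⟨KoszulDualDiLie.koszulDualDiLieIIso K,
    (KoszulDualDiLie.QuadraticData.operadCongr_gen _ _ _ _ _ _ _).trans
      (congrArg _ KoszulDualDiLie.dualRegular_fst)⟩
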